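/- Let $\mathcal X$ be a finite set and consider a finite-state Markov decision process on $\mathcal X$ with feasible control sets $U(i)$, transition distributions $P_i(u)$ ($u\in U(i)$) and costs $c(i,u)$. Fix a stationary deterministic policy $\pi$ with $\pi(i)\in U(i)$, and write $P_i=P_i(\pi(i))$ and $c^\pi(i)=c(i,\pi(i))$. Suppose that the Markov chain with transition matrix $P$ is a unichain (it has a single recurrent class, possibly with transient states), and let $q$ be its stationary distribution. Let $\alpha\in(0,1)$, let $\sigma_i(p,\cdot)$ ($i\in\mathcal X$, $p$ a probability distribution on $\mathcal X$) be coherent risk mappings on $\mathbb R^{\mathcal X}$ (convex, monotone, translation equivariant and positively homogeneous), and for $N\ge 1$ let $$\sigma^{(N)}_i(p,v)=\mathbb E\Big[\sigma_i\Big(\tfrac1N\sum_{m=1}^N\delta_{j^m},v\Big)\Big],\qquad j^1,\dots,j^N \text{ independent with law } p,$$ be the mini-batch risk mapping. Let $\Phi\in\mathbb R^{\mathcal X\times M}$ be a feature matrix with rows $\Phi_i$, let $\bar\theta\in\mathbb R^M$ be a reference parameter (the current iterate), let $\lambda>0$, and put $y_i=c^\pi(i)+\alpha\,\sigma_i^{(N)}(P_i,\Phi\bar\theta)$.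 Assume that the feature covariance matrix $\sum_{i}q_i\Phi_i^\top\Phi_i$ is nonsingular. Then the following holds. (a) For every path $s_0,s_1,\dots$ in $\mathcal X$ and every $T\ge1$, the regularized least-squares problem $$\min_\theta\ \frac1T\sum_{t=0}^{T-1}\big[\Phi_{s_t}\theta-y_{s_t}\big]^2+\frac{\lambda}{T}\|\theta\|^2$$ has the unique solution $$\hat\theta_T=\Big(\lambda I+\sum_{t=0}^{T-1}\Phi_{s_t}^\top\Phi_{s_t}\Big)^{-1}\sum_{t=0}^{T-1}\Phi_{s_t}^\top y_{s_t}.$$ (b) The exact problem $\min_\theta\sum_i q_i[\Phi_i\theta-y_i]^2$ has a unique solution $\theta^+$ (the exact next iterate). (c) For every initial distribution $P_0$, every $\delta>0$ and every $\varepsilon>0$ there is $T(\delta,\varepsilon)$ such that, whenever $s_0,s_1,\dots$ is a Markov chain with initial distribution $P_0$ and transition matrix $P$, for every $T\ge T(\delta,\varepsilon)$ we have $$\mathbb P\big\{\|\hat\theta_T-\theta^+\|\le\varepsilon\big\}\ge1-\delta ,$$ where $\|\cdot\|$ is the Euclidean norm. -/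

import Mathlib

open scoped Matrix

/-- A finite Markov decision process: feasible control sets `U(i)`, controlled transition
probabilities `P_i(u)` (an element of the simplex for each feasible `u`), and costs `c(i, u)`. -/
structure MDP (X C : Type*) [Fintype X] where
  /-- the feasible control set of each state -/
  feasible : X → Set C
  /-- the distribution of the next state -/
  trans : (i : X) → feasible i → stdSimplex ℝ X
  /-- the stage-wise cost -/
  cost : X → C → ℝ

namespace MDP

variable {X C : Type*} [Fintype X]

/-- A stationary deterministic Markov decision rule. -/
abbrev Policy (D : MDP X C) : Type _ := (i : X) → D.feasible i

/-- The transition probabilities `P^π` of the chain generated by a policy; row `i` is `P^π_i`. -/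
def policyTrans (D : MDP X C) (π : D.Policy) (i : X) : stdSimplex ℝ X := D.trans i (π i)

/-- The cost vector `c^π`. -/
def policyCost (D : MDP X C) (π : D.Policy) (i : X) : ℝ := D.cost i (π i)

end MDP

namespace Chain

variable {X : Type*} [Fintype X]

/-- State `j` is accessible from state `i`: there is a path (possibly of length zero) of
transitions of positive probability. -/
def Accessible (P : X → stdSimplex ℝ X) : X → X → Prop :=
  Relation.ReflTransGen fun i j => 0 < (P i).1 j

/-- A state of a finite chain is recurrent if it is accessible from every state that is
accessible from it. -/
def Recurrent (P : X → stdSimplex ℝ X) (i : X) : Prop :=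
  ∀ j, Accessible P i j → Accessible P j i

/-- A finite chain is a unichain if it has a single recurrent class (and possibly transient
states). A recurrent state always exists in a non-empty finite chain. -/
def IsUnichain (P : X → stdSimplex ℝ X) : Prop :=
  ∀ i j, Recurrent P i → Recurrent P j → Accessible P i j

/-- `q` is a stationary distribution: `q P = q`. -/
def IsStationary (P : X → stdSimplex ℝ X) (q : stdSimplex ℝ X) : Prop :=
  ∀ j, ∑ i, q.1 i * (P i).1 j = q.1 j

/-- The process `s` is a (time-homogeneous) Markov chain with initial distribution `P₀` and
transition probabilities `P`, expressed through its finite-dimensional distributions. -/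
structure IsMarkovChain (P₀ : stdSimplex ℝ X) (P : X → stdSimplex ℝ X) {Ω : Type*}
    [MeasurableSpace Ω] (μ : MeasureTheory.Measure Ω) (s : ℕ → Ω → X) : Prop where
  measurable : ∀ t x, MeasurableSet {ω | s t ω = x}
  path : ∀ (n : ℕ) (x : ℕ → X), μ.real {ω | ∀ k ≤ n, s k ω = x k} =
    P₀.1 (x 0) * ∏ k ∈ Finset.range n, (P (x k)).1 (x (k + 1))

end Chain

namespace Risk

variable {X : Type*} [Fintype X]

/-- The axioms of a coherent measure of risk on the functions on `X`. -/
structure IsCoherent (ρ : (X → ℝ) → ℝ) : Prop where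
  convex : ∀ (v w : X → ℝ) (l : ℝ), 0 ≤ l → l ≤ 1 →
    ρ (l • v + (1 - l) • w) ≤ l * ρ v + (1 - l) * ρ w
  monotone : ∀ v w : X → ℝ, v ≤ w → ρ v ≤ ρ w
  translation : ∀ (v : X → ℝ) (b : ℝ), ρ (fun i => v i + b) = ρ v + b
  pos_homogeneous : ∀ (a : ℝ) (v : X → ℝ), 0 ≤ a → ρ (a • v) = a * ρ v

/-- The empirical measure `(1/N) ∑ₘ δ_{jᵐ}` of a sample of size `N ≥ 1`. -/
noncomputable def empirical [DecidableEq X] {N : ℕ} [NeZero N] (j : Fin N → X) :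
    stdSimplex ℝ X :=
  ⟨fun x => (1 / (N : ℝ)) * ∑ m, if j m = x then 1 else 0, by
    refine ⟨fun x => by positivity, ?_⟩
    have hN : (N : ℝ) ≠ 0 := Nat.cast_ne_zero.mpr (NeZero.ne N)
    rw [← Finset.mul_sum, Finset.sum_comm]
    simp [hN]⟩

/-- The mini-batch transition risk mapping
`σ⁽ᴺ⁾_i(p, v) = 𝔼 [σ_i(P⁽ᴺ⁾(j¹, …, jᴺ), v)]`, where `j¹, …, jᴺ` are independent with law `p`. -/
noncomputable def miniBatch [DecidableEq X] (σ : X → stdSimplex ℝ X → (X → ℝ) → ℝ) (N : ℕ)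
    [NeZero N] (i : X) (p : stdSimplex ℝ X) (v : X → ℝ) : ℝ :=
  ∑ j : Fin N → X, (∏ m, p.1 (j m)) * σ i (empirical j) v

end Risk

namespace PolicyEval

variable {X : Type*} [Fintype X] {M : ℕ}

/-- The feature covariance matrix `𝔼[φ φᵀ]`, where `φ = Φᵢᵀ` and `i ∼ q`. -/
def featureCov (Φ : Matrix X (Fin M) ℝ) (q : stdSimplex ℝ X) : Matrix (Fin M) (Fin M) ℝ :=
  ∑ i, q.1 i • Matrix.vecMulVec (Φ i) (Φ i)

/-- The regression target `c(i) + α ρ_i(P_i, Φ θ̄)` at state `i`, for a reference parameter `θ̄`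
and a transition risk mapping `ρ`. -/
def target (P : X → stdSimplex ℝ X) (c : X → ℝ) (α : ℝ)
    (ρ : X → stdSimplex ℝ X → (X → ℝ) → ℝ) (Φ : Matrix X (Fin M) ℝ)
    (θref : EuclideanSpace ℝ (Fin M)) (i : X) : ℝ :=
  c i + α * ρ i (P i) (Φ *ᵥ θref.ofLp)

/-- The exact objective `𝔼_{i ∼ q} [Φᵢ θ - yᵢ]²` with targets `y`. -/
def exactObjective (q : stdSimplex ℝ X) (Φ : Matrix X (Fin M) ℝ) (y : X → ℝ)
    (θ : EuclideanSpace ℝ (Fin M)) : ℝ :=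
  ∑ i, q.1 i * ((Φ *ᵥ θ.ofLp) i - y i) ^ 2

/-- The regularized least-squares objective
`(1/T) ∑_{t < T} [Φ_{s_t} θ - y_{s_t}]² + (lam/T) ‖θ‖²` along a path `s`. -/
noncomputable def sampleObjective (lam : ℝ) (Φ : Matrix X (Fin M) ℝ) (y : X → ℝ) (s : ℕ → X)
    (T : ℕ) (θ : EuclideanSpace ℝ (Fin M)) : ℝ :=
  (1 / (T : ℝ)) * ∑ t ∈ Finset.range T, ((Φ *ᵥ θ.ofLp) (s t) - y (s t)) ^ 2
    + (lam / (T : ℝ)) * ‖θ‖ ^ 2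

/-- `Λ_T = lam I + ∑_{t < T} φ_t φ_tᵀ`, with `φ_t = (Φ_{s_t})ᵀ`. -/
def gram (lam : ℝ) (Φ : Matrix X (Fin M) ℝ) (s : ℕ → X) (T : ℕ) : Matrix (Fin M) (Fin M) ℝ :=
  lam • (1 : Matrix (Fin M) (Fin M) ℝ)
    + ∑ t ∈ Finset.range T, Matrix.vecMulVec (Φ (s t)) (Φ (s t))

/-- The regularized least-squares solution `Λ_T⁻¹ ∑_{t < T} φ_t y_{s_t}`. -/
noncomputable def rlsSolution (lam : ℝ) (Φ : Matrix X (Fin M) ℝ) (y : X → ℝ) (s : ℕ → X)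
    (T : ℕ) : EuclideanSpace ℝ (Fin M) :=
  WithLp.toLp 2 ((gram lam Φ s T)⁻¹ *ᵥ ∑ t ∈ Finset.range T, y (s t) • Φ (s t))

end PolicyEval

/-! Both least-squares problems are strictly convex quadratics, so (a) and (b) are their normal
equations. Dividing these by `T` exhibits the regularized solution as a function `weightedSolution`
of the pair (1/T, empirical state frequencies); the exact solution is its value at (0, q), where it
is continuous because the feature covariance is invertible. Thus (c) reduces to a weak law of large
numbers for the frequencies, with a threshold that does not depend on the probability space.

The chain may be periodic, so the law does not go through convergence of the powers of P. Harmonic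
functions of a unichain are constant, hence the Poisson equation g - Pg = f - q(f) is solvable
(`IsUnichain.exists_poisson`). Its solution turns the centred sum of f along the path into a bounded
boundary term plus a martingale with second moment O(T), and Chebyshev's inequality concludes. -/

namespace Chain

/-! ### Recurrence, harmonic functions and the Poisson equation -/

variable {X : Type*} [Fintype X] {P : X → stdSimplex ℝ X}

/-- Among the states accessible from `i`, one whose own accessible set is smallest must be
recurrent: moving on from it cannot shrink that set. -/
theorem exists_recurrent_accessible (P : X → stdSimplex ℝ X) (i : X) :
    ∃ j, Accessible P i j ∧ Recurrent P j := by
  classical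
  obtain ⟨j, hij, hmin⟩ := Set.exists_min_image {j | Accessible P i j}
    (fun j => {k | Accessible P j k}.ncard) (Set.toFinite _) ⟨i, Relation.ReflTransGen.refl⟩
  refine ⟨j, hij, fun k hjk => ?_⟩
  have hsub : {l | Accessible P k l} ⊆ {l | Accessible P j l} := fun l hl => hjk.trans hl
  have heq := Set.eq_of_subset_of_ncard_le hsub (hmin k (hij.trans hjk)) (Set.toFinite _)
  have hj : j ∈ {l | Accessible P j l} := Relation.ReflTransGen.refl
  rw [← heq] at hj
  exact hj

/-- The transition operator `(P g)(i) = ∑ⱼ Pᵢ(j) g(j)`. -/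
def mean (P : X → stdSimplex ℝ X) (g : X → ℝ) (i : X) : ℝ := ∑ j, (P i).1 j * g j

/-- Maximum principle: an average equal to the maximum forces equality at every successor of
positive probability. -/
theorem eq_of_accessible_of_isMax {h : X → ℝ} (hh : ∀ i, mean P h i = h i) {i j : X}
    (hi : ∀ k, h k ≤ h i) (hij : Accessible P i j) : h j = h i := by
  induction hij with
  | refl => rfl
  | @tail a b _ hab ih =>
    have h0 : ∑ k, (P a).1 k * (h i - h k) = 0 := by
      have h1 := hh a
      rw [ih, mean] at h1
      simp only [mul_sub, Finset.sum_sub_distrib, ← Finset.sum_mul, (P a).2.2, h1]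
      ring
    have h2 := (Finset.sum_eq_zero_iff_of_nonneg fun k _ =>
      mul_nonneg ((P a).2.1 k) (sub_nonneg.2 (hi k))).1 h0 b (Finset.mem_univ b)
    rcases mul_eq_zero.1 h2 with h3 | h3
    · exact absurd h3 hab.ne'
    · linarith

/-- The harmonic functions of a unichain are constant. -/
theorem IsUnichain.eq_of_mean_eq (hP : IsUnichain P) {h : X → ℝ} (hh : ∀ i, mean P h i = h i)
    (i j : X) : h i = h j := by
  have : Nonempty X := ⟨i⟩
  obtain ⟨a, ha⟩ := Finite.exists_max h
  obtain ⟨b, hb⟩ := Finite.exists_min h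
  obtain ⟨a', haa, hra⟩ := exists_recurrent_accessible P a
  obtain ⟨b', hbb, hrb⟩ := exists_recurrent_accessible P b
  -- The value at the recurrent state `b'` is both the maximum and the minimum of `h`, since `b'` is
  -- reached from `a` (through `a'`) and from `b`.
  have h1 : h b' = h a := eq_of_accessible_of_isMax hh ha (haa.trans (hP a' b' hra hrb))
  have h2 : -h b' = -h b := by
    refine eq_of_accessible_of_isMax (P := P) (h := fun k => -h k) (fun k => ?_)
      (fun k => neg_le_neg (hb k)) hbb
    simp only [mean, mul_neg, Finset.sum_neg_distrib]
    exact congrArg Neg.neg (hh k)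
  have := ha i; have := ha j; have := hb i; have := hb j
  linarith

theorem IsStationary.sum_mul_mean {q : stdSimplex ℝ X} (hq : IsStationary P q) (g : X → ℝ) :
    ∑ i, q.1 i * mean P g i = ∑ i, q.1 i * g i := by
  simp only [mean, Finset.mul_sum]
  rw [Finset.sum_comm]
  refine Finset.sum_congr rfl fun j _ => ?_
  rw [← hq j, Finset.sum_mul]
  exact Finset.sum_congr rfl fun i _ => by ring

/-- The Poisson equation of a unichain is solvable. -/
theorem IsUnichain.exists_poisson (hP : IsUnichain P) {q : stdSimplex ℝ X}
    (hq : IsStationary P q) (f : X → ℝ) :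
    ∃ g : X → ℝ, ∀ i, g i - mean P g i = f i - ∑ j, q.1 j * f j := by
  -- `I - P` is singular on constants; adding the rank-one map g ↦ q(g)·1 makes it injective, hence
  -- surjective in finite dimension.
  let L : (X → ℝ) →ₗ[ℝ] (X → ℝ) :=
    { toFun := fun g i => g i - mean P g i + ∑ j, q.1 j * g j
      map_add' := fun g g' => by
        ext i
        simp only [mean, Pi.add_apply, mul_add, Finset.sum_add_distrib]
        ring
      map_smul' := fun r g => by
        ext i
        simp only [mean, Pi.smul_apply, smul_eq_mul, mul_left_comm _ r, ← Finset.mul_sum,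
          RingHom.id_apply]
        ring }
  have hL : ∀ g i, L g i = g i - mean P g i + ∑ j, q.1 j * g j := fun _ _ => rfl
  have hqL : ∀ g, ∑ i, q.1 i * L g i = ∑ i, q.1 i * g i := fun g => by
    simp only [hL, mul_add, mul_sub, Finset.sum_add_distrib, Finset.sum_sub_distrib,
      hq.sum_mul_mean, ← Finset.sum_mul, q.2.2]
    ring
  have hinj : Function.Injective L := by
    rw [injective_iff_map_eq_zero]
    intro g hg
    have h0 : ∑ i, q.1 i * g i = 0 := by rw [← hqL, hg]; simp
    have hharm : ∀ i, mean P g i = g i := fun i => by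
      have := hL g i
      rw [hg, h0] at this
      simp only [Pi.zero_apply] at this
      linarith
    ext i
    have hc : ∑ j, q.1 j * g j = g i := by
      simp only [hP.eq_of_mean_eq hharm _ i, ← Finset.sum_mul, q.2.2, one_mul]
    rw [← hc, h0, Pi.zero_apply]
  -- For L g = f, integrating against q gives q(g) = q(f), so the added term is exactly the centring
  -- constant.
  obtain ⟨g, hg⟩ := LinearMap.injective_iff_surjective.1 hinj f
  refine ⟨g, fun i => ?_⟩
  have h1 := hqL g
  have h2 := hL g i
  rw [hg] at h1 h2
  linarith

/-! ### Martingale increments along the chain -/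

section SamplePaths

open MeasureTheory

variable {Ω : Type*} [MeasurableSpace Ω] {μ : Measure Ω}
  {P₀ : stdSimplex ℝ X} {s : ℕ → Ω → X}

/-- The one-step Markov property, recovered as a ratio of consecutive path probabilities. -/
theorem IsMarkovChain.real_path_succ (hs : IsMarkovChain P₀ P μ s) (n : ℕ) (x : ℕ → X) (z : X) :
    μ.real {ω | (∀ k ≤ n, s k ω = x k) ∧ s (n + 1) ω = z} =
      μ.real {ω | ∀ k ≤ n, s k ω = x k} * (P (x n)).1 z := by
  classical
  have h1 := hs.path (n + 1) (Function.update x (n + 1) z)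
  have hu : ∀ k ≤ n, Function.update x (n + 1) z k = x k := fun k hk =>
    Function.update_of_ne (by omega) _ _
  have hset : {ω | (∀ k ≤ n, s k ω = x k) ∧ s (n + 1) ω = z} =
      {ω | ∀ k ≤ n + 1, s k ω = Function.update x (n + 1) z k} := by
    ext ω
    simp only [Set.mem_ofPred_eq]
    constructor
    · rintro ⟨h, hz⟩ k hk
      rcases Nat.lt_or_ge n k with h' | h'
      · obtain rfl : k = n + 1 := by omega
        simpa using hz
      · rw [hu k h', h k h']
    · intro h
      exact ⟨fun k hk => by rw [h k (by omega), hu k hk], by simpa using h (n + 1) le_rfl⟩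
  rw [hset, h1, hs.path n x, Finset.prod_range_succ, hu 0 (Nat.zero_le n), hu n le_rfl,
    Function.update_self, mul_assoc]
  congr 2
  refine Finset.prod_congr rfl fun k hk => ?_
  have := Finset.mem_range.1 hk
  rw [hu k this.le, hu (k + 1) this]

/-- A function of finitely many coordinates of the process is measurable. -/
theorem IsMarkovChain.measurable_comp (hs : IsMarkovChain P₀ P μ s) (n : ℕ)
    (F : (Fin n → X) → ℝ) : Measurable fun ω => F fun k => s k ω := by
  let _ : MeasurableSpace X := ⊤
  have h1 : ∀ k, Measurable (s k) := fun k => measurable_to_countable' fun x => hs.measurable k x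
  exact (measurable_of_countable F).comp (measurable_pi_lambda _ fun k => h1 k)

theorem IsMarkovChain.integrable_comp [IsProbabilityMeasure μ]
    (hs : IsMarkovChain P₀ P μ s) (n : ℕ) (F : (Fin n → X) → ℝ) :
    Integrable (fun ω => F fun k => s k ω) μ := by
  classical
  refine Integrable.of_bound (hs.measurable_comp n F).aestronglyMeasurable
    (∑ x, ‖F x‖) (ae_of_all _ fun ω => ?_)
  exact Finset.single_le_sum (f := fun x => ‖F x‖) (fun _ _ => norm_nonneg _) (Finset.mem_univ _)

/-- The increments `g(s_{n+1}) - (P g)(s_n)` are orthogonal to the past. -/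
theorem IsMarkovChain.integral_mul_increment [IsProbabilityMeasure μ]
    (hs : IsMarkovChain P₀ P μ s) (g : X → ℝ) (n : ℕ)
    (F : (Fin (n + 1) → X) → ℝ) :
    ∫ ω, F (fun k => s k ω) * (g (s (n + 1) ω) - mean P g (s n ω)) ∂μ = 0 := by
  classical
  let _ : MeasurableSpace X := ⊤
  have h1 : ∀ k, Measurable (s k) := fun k => measurable_to_countable' fun x => hs.measurable k x
  let Z : Ω → (Fin (n + 1) → X) × X := fun ω => (fun k => s k ω, s (n + 1) ω)
  have hZ : Measurable Z :=
    (measurable_pi_lambda (fun ω (k : Fin (n + 1)) => s k ω) fun k => h1 k).prodMk (h1 (n + 1))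
  let G : (Fin (n + 1) → X) × X → ℝ := fun p => F p.1 * (g p.2 - mean P g (p.1 (Fin.last n)))
  have hG : ∫ ω, F (fun k => s k ω) * (g (s (n + 1) ω) - mean P g (s n ω)) ∂μ =
      ∫ p, G p ∂(μ.map Z) := by
    rw [integral_map hZ.aemeasurable (measurable_of_countable G).aestronglyMeasurable]
    simp [G, Z]
  have : IsProbabilityMeasure (μ.map Z) := Measure.isProbabilityMeasure_map hZ.aemeasurable
  rw [hG, integral_fintype Integrable.of_finite, Fintype.sum_prod_type]
  refine Finset.sum_eq_zero fun x _ => ?_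
  -- Path probabilities are indexed by infinite sequences; only the entries up to `n` of this
  -- periodic extension matter.
  let x' : ℕ → X := fun k => x (Fin.ofNat (n + 1) k)
  have hx' : ∀ k : Fin (n + 1), x' k = x k := fun k => by simp [x']
  have hn : x' n = x (Fin.last n) := by simpa using hx' (Fin.last n)
  have hz : ∀ z, (μ.map Z).real {(x, z)} =
      μ.real {ω | ∀ k ≤ n, s k ω = x' k} * (P (x (Fin.last n))).1 z := fun z => by
    rw [map_measureReal_apply hZ (measurableSet_singleton _), ← hn, ← hs.real_path_succ]
    congr 1
    ext ω
    simp only [Set.mem_preimage, Set.mem_singleton_iff, Z, Prod.mk.injEq, Set.mem_ofPred_eq,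
      funext_iff]
    refine and_congr_left fun _ => ⟨fun h k hk => ?_, fun h k => ?_⟩
    · exact (h ⟨k, by omega⟩).trans (hx' ⟨k, by omega⟩).symm
    · rw [h k (by omega), hx']
  have key : ∑ z, (P (x (Fin.last n))).1 z * (g z - mean P g (x (Fin.last n))) = 0 := by
    simp only [mul_sub, Finset.sum_sub_distrib, ← Finset.sum_mul, (P _).2.2, one_mul]
    exact sub_self _
  calc _ = ∑ z, (μ.real {ω | ∀ k ≤ n, s k ω = x' k} * F x) *
        ((P (x (Fin.last n))).1 z * (g z - mean P g (x (Fin.last n)))) :=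
        Finset.sum_congr rfl fun z _ => by rw [hz]; simp only [G, smul_eq_mul]; ring
    _ = 0 := by rw [← Finset.mul_sum, key, mul_zero]

/-- The second moment of the martingale `∑ₜ (g(s_{t+1}) - (P g)(s_t))` grows linearly. -/
theorem IsMarkovChain.integral_sq_martingale_le [IsProbabilityMeasure μ]
    (hs : IsMarkovChain P₀ P μ s) (g : X → ℝ) {K : ℝ}
    (hK : ∀ i j, (g j - mean P g i) ^ 2 ≤ K) (T : ℕ) :
    ∫ ω, (∑ t ∈ Finset.range T, (g (s (t + 1) ω) - mean P g (s t ω))) ^ 2 ∂μ ≤ T * K := by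
  induction T with
  | zero => simp
  | succ n ih =>
    let S : (Fin (n + 1) → X) → ℝ := fun x =>
      ∑ t : Fin n, (g (x t.succ) - mean P g (x t.castSucc))
    have hS : ∀ ω, ∑ t ∈ Finset.range n, (g (s (t + 1) ω) - mean P g (s t ω)) =
        S fun k => s k ω := fun ω => by
      rw [Finset.sum_range]
      simp [S]
    simp only [Finset.sum_range_succ, hS, add_sq, mul_assoc] at ih ⊢
    have i1 := hs.integrable_comp (n + 1) fun x => S x ^ 2
    have i2 := hs.integrable_comp (n + 2) fun x => 2 * (S (fun k => x k.castSucc) *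
      (g (x (Fin.last (n + 1))) - mean P g (x (Fin.last n).castSucc)))
    have i3 := hs.integrable_comp (n + 2) fun x =>
      (g (x (Fin.last (n + 1))) - mean P g (x (Fin.last n).castSucc)) ^ 2
    simp only [Fin.val_last, Fin.val_castSucc] at i2 i3
    have h12 := integral_add i1 i2
    have h123 := integral_add (i1.add i2) i3
    -- The cross term vanishes by orthogonality, so each step adds at most `K`.
    rw [integral_const_mul, hs.integral_mul_increment] at h12
    simp only [Pi.add_apply] at h123
    have h3 : ∫ ω, (g (s (n + 1) ω) - mean P g (s n ω)) ^ 2 ∂μ ≤ K := by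
      calc _ ≤ ∫ _, K ∂μ := integral_mono i3 (integrable_const K) fun ω => hK _ _
        _ = K := by simp
    rw [h123, h12]
    push_cast
    linarith

end SamplePaths

/-! ### Mean ergodic theorem and weak law for the state frequencies -/

/-- Quadratic mean ergodic theorem for unichains, with rate. -/
theorem IsUnichain.exists_integral_sq_le (hP : IsUnichain P) {q : stdSimplex ℝ X}
    (hq : IsStationary P q) (f : X → ℝ) :
    ∃ K : ℝ, 0 ≤ K ∧ ∀ (Ω : Type*) [MeasurableSpace Ω] (μ : MeasureTheory.Measure Ω)
      [MeasureTheory.IsProbabilityMeasure μ] (P₀ : stdSimplex ℝ X) (s : ℕ → Ω → X),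
      IsMarkovChain P₀ P μ s → ∀ T : ℕ,
        ∫ ω, (∑ t ∈ Finset.range T, (f (s t ω) - ∑ j, q.1 j * f j)) ^ 2 ∂μ ≤ K * (T + 1) := by
  obtain ⟨g, hg⟩ := hP.exists_poisson hq f
  let K₁ := ∑ p : X × X, (g p.2 - mean P g p.1) ^ 2
  let K₂ := ∑ p : X × X, (g p.1 - g p.2) ^ 2
  have hK₁ : ∀ i j, (g j - mean P g i) ^ 2 ≤ K₁ := fun i j =>
    Finset.single_le_sum (f := fun p : X × X => (g p.2 - mean P g p.1) ^ 2)
      (fun _ _ => sq_nonneg _) (Finset.mem_univ (i, j))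
  have hK₂ : ∀ i j, (g i - g j) ^ 2 ≤ K₂ := fun i j =>
    Finset.single_le_sum (f := fun p : X × X => (g p.1 - g p.2) ^ 2)
      (fun _ _ => sq_nonneg _) (Finset.mem_univ (i, j))
  have h₁ : 0 ≤ K₁ := Finset.sum_nonneg fun _ _ => sq_nonneg _
  have h₂ : 0 ≤ K₂ := Finset.sum_nonneg fun _ _ => sq_nonneg _
  refine ⟨2 * K₁ + 2 * K₂, by positivity, fun Ω _ μ _ P₀ s hs T => ?_⟩
  let m : Ω → ℝ := fun ω => ∑ t ∈ Finset.range T, (g (s (t + 1) ω) - mean P g (s t ω))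
  -- g(s_t) - Pg(s_t) splits into g(s_t) - g(s_{t+1}), which telescopes, and a martingale increment.
  have hm : ∀ ω, ∑ t ∈ Finset.range T, (f (s t ω) - ∑ j, q.1 j * f j) =
      (g (s 0 ω) - g (s T ω)) + m ω := fun ω => by
    rw [← Finset.sum_range_sub' (fun t => g (s t ω)), ← Finset.sum_add_distrib]
    refine Finset.sum_congr rfl fun t _ => ?_
    rw [← hg]
    ring
  have im : MeasureTheory.Integrable (fun ω => m ω ^ 2) μ := by
    have := hs.integrable_comp (T + 1) fun x =>
      (∑ t : Fin T, (g (x t.succ) - mean P g (x t.castSucc))) ^ 2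
    simpa only [m, Finset.sum_range, Fin.val_succ, Fin.val_castSucc] using this
  have i0 : MeasureTheory.Integrable
      (fun ω => (∑ t ∈ Finset.range T, (f (s t ω) - ∑ j, q.1 j * f j)) ^ 2) μ := by
    have := hs.integrable_comp T fun x => (∑ t : Fin T, (f (x t) - ∑ j, q.1 j * f j)) ^ 2
    simpa only [Finset.sum_range] using this
  have hM : ∫ ω, m ω ^ 2 ∂μ ≤ T * K₁ := hs.integral_sq_martingale_le g hK₁ T
  calc _ ≤ ∫ ω, (2 * K₂ + 2 * m ω ^ 2) ∂μ :=
        MeasureTheory.integral_mono i0 ((MeasureTheory.integrable_const _).add (im.const_mul 2))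
          fun ω => by
            simp only [hm]
            nlinarith [hK₂ (s 0 ω) (s T ω), sq_nonneg (g (s 0 ω) - g (s T ω) - m ω)]
    _ = 2 * K₂ + 2 * ∫ ω, m ω ^ 2 ∂μ := by
        rw [MeasureTheory.integral_add (MeasureTheory.integrable_const _) (im.const_mul 2)]
        simp [MeasureTheory.integral_const_mul]
    _ ≤ (2 * K₁ + 2 * K₂) * (T + 1) := by
        have : (0 : ℝ) ≤ T := Nat.cast_nonneg T
        nlinarith [mul_nonneg this h₂]

/-- The fraction of time that a path spends in each state before time `T`. -/
noncomputable def empiricalFreq [DecidableEq X] (s : ℕ → X) (T : ℕ) (i : X) : ℝ :=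
  (1 / (T : ℝ)) * ∑ t ∈ Finset.range T, if s t = i then 1 else 0

theorem sum_empiricalFreq_smul [DecidableEq X] {E : Type*} [AddCommGroup E] [Module ℝ E]
    (s : ℕ → X) (T : ℕ) (v : X → E) :
    ∑ i, empiricalFreq s T i • v i = (1 / (T : ℝ)) • ∑ t ∈ Finset.range T, v (s t) := by
  simp only [empiricalFreq, mul_smul, ← Finset.smul_sum, Finset.sum_smul]
  rw [Finset.sum_comm]
  simp

/-- The weak law of large numbers for the empirical frequencies of a unichain, uniformly over all
realizations of the chain. -/
theorem IsUnichain.exists_forall_real_dist_lt [DecidableEq X] (hP : IsUnichain P)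
    {q : stdSimplex ℝ X} (hq : IsStationary P q) {δ : ℝ} (hδ : 0 < δ) {η : ℝ} (hη : 0 < η) :
    ∃ T₀ : ℕ, ∀ (Ω : Type*) [MeasurableSpace Ω] (μ : MeasureTheory.Measure Ω)
      [MeasureTheory.IsProbabilityMeasure μ] (P₀ : stdSimplex ℝ X) (s : ℕ → Ω → X),
      IsMarkovChain P₀ P μ s → ∀ T : ℕ, T₀ ≤ T →
        1 - δ ≤ μ.real {ω | dist (empiricalFreq (fun t => s t ω) T) q.1 < η} := by
  choose K hK0 hK using fun i : X => hP.exists_integral_sq_le hq fun j => if j = i then 1 else 0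
  simp only [mul_ite, mul_one, mul_zero, Finset.sum_ite_eq', Finset.mem_univ, if_true] at hK
  have hS : 0 ≤ ∑ i, K i := Finset.sum_nonneg fun i _ => hK0 i
  -- Chebyshev gives at most K_i(T+1)/(Tη)² ≤ 2K_i/(Tη²) for each state; the union bound over states
  -- falls below δ past this threshold. The shift to `T₀ + 1` ensures T ≥ 1.
  obtain ⟨T₀, hT₀⟩ := exists_nat_gt (2 * (∑ i, K i) / (δ * η ^ 2))
  refine ⟨T₀ + 1, fun Ω _ μ _ P₀ s hs T hT => ?_⟩
  have hT1 : (1 : ℝ) ≤ T := by exact_mod_cast (by omega : 1 ≤ T)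
  have hT0 : (0 : ℝ) < T := by linarith
  let D : X → Ω → ℝ := fun i ω => ∑ t ∈ Finset.range T, ((if s t ω = i then 1 else 0) - q.1 i)
  have hD : ∀ i ω, empiricalFreq (fun t => s t ω) T i - q.1 i = D i ω / T := fun i ω => by
    simp only [D, empiricalFreq, Finset.sum_sub_distrib, Finset.sum_const, Finset.card_range,
      nsmul_eq_mul]
    field_simp
  have hcompl : {ω | dist (empiricalFreq (fun t => s t ω) T) q.1 < η}ᶜ ⊆
      ⋃ i, {ω | (T * η) ^ 2 ≤ D i ω ^ 2} := fun ω hω => by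
    by_contra hc
    simp only [Set.mem_iUnion, Set.mem_ofPred_eq, not_exists, not_le] at hc
    refine hω ((dist_pi_lt_iff hη).2 fun i => ?_)
    rw [Real.dist_eq, hD, abs_div, abs_of_pos hT0, div_lt_iff₀ hT0, mul_comm]
    exact lt_of_pow_lt_pow_left₀ 2 (by positivity) (by rw [sq_abs]; exact hc i)
  have hi : ∀ i, μ.real {ω | (T * η) ^ 2 ≤ D i ω ^ 2} ≤ K i * (2 / (T * η ^ 2)) := fun i => by
    have iD : MeasureTheory.Integrable (fun ω => D i ω ^ 2) μ := by
      have := hs.integrable_comp T fun x =>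
        (∑ t : Fin T, ((if x t = i then 1 else 0) - q.1 i)) ^ 2
      simpa only [D, Finset.sum_range] using this
    have h1 := MeasureTheory.mul_meas_ge_le_integral_of_nonneg
      (MeasureTheory.ae_of_all μ fun ω => sq_nonneg (D i ω)) iD ((T * η) ^ 2)
    have h2 := h1.trans (hK i Ω μ P₀ s hs T)
    have h3 : K i * (T + 1) ≤ K i * (2 * T) := mul_le_mul_of_nonneg_left (by linarith) (hK0 i)
    rw [← le_div_iff₀' (by positivity)] at h2
    refine h2.trans ((div_le_div_of_nonneg_right h3 (by positivity)).trans_eq ?_)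
    field_simp
  have hmeas : MeasurableSet {ω | dist (empiricalFreq (fun t => s t ω) T) q.1 < η} := by
    have := hs.measurable_comp T fun x =>
      dist (fun i => (1 / (T : ℝ)) * ∑ t : Fin T, if x t = i then 1 else 0) q.1
    have he : ∀ ω, empiricalFreq (fun t => s t ω) T =
        fun i => (1 / (T : ℝ)) * ∑ t : Fin T, if s t ω = i then 1 else 0 := fun ω => by
      ext i
      rw [empiricalFreq, Finset.sum_range]
    simp only [he]
    exact measurableSet_lt this measurable_const
  have htot : μ.real {ω | dist (empiricalFreq (fun t => s t ω) T) q.1 < η}ᶜ ≤ δ := by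
    refine (MeasureTheory.measureReal_mono hcompl).trans
      ((MeasureTheory.measureReal_iUnion_fintype_le _).trans
        ((Finset.sum_le_sum fun i _ => hi i).trans ?_))
    rw [← Finset.sum_mul]
    have h4 : 2 * (∑ i, K i) / (δ * η ^ 2) < T :=
      hT₀.trans_le (by exact_mod_cast (by omega : T₀ ≤ T))
    rw [div_lt_iff₀ (by positivity)] at h4
    rw [← mul_div_assoc, div_le_iff₀ (by positivity)]
    linarith
  rw [MeasureTheory.probReal_compl_eq_one_sub hmeas] at htot
  linarith

end Chain

/-! ### Normal equations and stability of their solution -/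

namespace PolicyEval

variable {X : Type*} [Fintype X] {M : ℕ}

open Matrix

/-- Completing the square at A⁻¹b leaves a positive definite form in the displacement. Serves both
the sampled and the exact problem. -/
theorem isMinOn_quadratic_iff {A : Matrix (Fin M) (Fin M) ℝ} (hA : A.PosDef) (b : Fin M → ℝ)
    {k : ℝ} (hk : 0 < k) (c : ℝ) {J : EuclideanSpace ℝ (Fin M) → ℝ}
    (hJ : ∀ θ, J θ = k * (θ.ofLp ⬝ᵥ A *ᵥ θ.ofLp - 2 * (θ.ofLp ⬝ᵥ b)) + c)
    (θ : EuclideanSpace ℝ (Fin M)) :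
    IsMinOn J Set.univ θ ↔ θ = WithLp.toLp 2 (A⁻¹ *ᵥ b) := by
  set θ' : EuclideanSpace ℝ (Fin M) := WithLp.toLp 2 (A⁻¹ *ᵥ b) with hθ'
  have hb : A *ᵥ θ'.ofLp = b := by
    rw [hθ', mulVec_mulVec, mul_nonsing_inv _ hA.det_pos.ne'.isUnit, one_mulVec]
  have hsymm : Aᵀ = A := by simpa using hA.isHermitian.eq
  have hdiff : ∀ η, J η = J θ' + k * ((η.ofLp - θ'.ofLp) ⬝ᵥ A *ᵥ (η.ofLp - θ'.ofLp)) := fun η => by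
    have h1 : θ'.ofLp ⬝ᵥ A *ᵥ η.ofLp = η.ofLp ⬝ᵥ b := by
      rw [dotProduct_mulVec, ← mulVec_transpose, hsymm, hb, dotProduct_comm]
    rw [hJ, hJ, mulVec_sub, dotProduct_sub, sub_dotProduct, sub_dotProduct, h1, hb]
    ring
  have hpos : ∀ η : EuclideanSpace ℝ (Fin M), η ≠ θ' →
      0 < (η.ofLp - θ'.ofLp) ⬝ᵥ A *ᵥ (η.ofLp - θ'.ofLp) := fun η hη => by
    have := hA.dotProduct_mulVec_pos (x := η.ofLp - θ'.ofLp)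
      (sub_ne_zero.2 fun h => hη (WithLp.ofLp_injective 2 h))
    simpa using this
  rw [isMinOn_univ_iff]
  constructor
  · intro h
    by_contra hne
    have := h θ'
    rw [hdiff θ] at this
    have := mul_pos hk (hpos θ hne)
    linarith
  · rintro rfl η
    rw [hdiff η]
    rcases eq_or_ne η θ' with rfl | hne
    · simp
    · have := mul_pos hk (hpos η hne)
      linarith

theorem dotProduct_vecMulVec_mulVec (v x : Fin M → ℝ) :
    x ⬝ᵥ vecMulVec v v *ᵥ x = (v ⬝ᵥ x) ^ 2 := by
  rw [vecMulVec_mulVec]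
  simp [dotProduct_comm x v, sq]

theorem posSemidef_vecMulVec (v : Fin M → ℝ) : (vecMulVec v v).PosSemidef := by
  simpa using posSemidef_vecMulVec_self_star v

theorem posDef_featureCov {Φ : Matrix X (Fin M) ℝ} {q : stdSimplex ℝ X}
    (hΦ : (featureCov Φ q).det ≠ 0) : (featureCov Φ q).PosDef := by
  have h : (featureCov Φ q).PosSemidef :=
    posSemidef_sum _ fun i _ => (posSemidef_vecMulVec (Φ i)).smul (q.2.1 i)
  exact h.posDef_iff_isUnit.2 ((isUnit_iff_isUnit_det _).2 hΦ.isUnit)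

theorem posDef_gram {S : Type*} {lam : ℝ} (hlam : 0 < lam) (Φ : Matrix S (Fin M) ℝ) (s : ℕ → S)
    (T : ℕ) :
    (gram lam Φ s T).PosDef :=
  (PosDef.one.smul hlam).add_posSemidef (posSemidef_sum _ fun _ _ => posSemidef_vecMulVec _)

theorem isMinOn_sampleObjective_iff {S : Type*} {lam : ℝ} (hlam : 0 < lam)
    (Φ : Matrix S (Fin M) ℝ) (y : S → ℝ) (s : ℕ → S) {T : ℕ} (hT : 1 ≤ T) (θ : EuclideanSpace ℝ (Fin M)) :
    IsMinOn (sampleObjective lam Φ y s T) Set.univ θ ↔ θ = rlsSolution lam Φ y s T := by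
  have hT0 : (0 : ℝ) < T := by exact_mod_cast hT
  refine isMinOn_quadratic_iff (posDef_gram hlam Φ s T) _ (one_div_pos.2 hT0)
    ((1 / (T : ℝ)) * ∑ t ∈ Finset.range T, y (s t) ^ 2) (fun θ => ?_) θ
  have h1 : θ.ofLp ⬝ᵥ θ.ofLp = ‖θ‖ ^ 2 := by
    rw [EuclideanSpace.norm_sq_eq]
    simp [dotProduct, sq]
  simp only [sampleObjective, gram, add_mulVec, sum_mulVec, smul_mulVec, one_mulVec,
    dotProduct_add, dotProduct_smul, dotProduct_sum, dotProduct_vecMulVec_mulVec, smul_eq_mul, h1]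
  have h2 : ∀ t, ((Φ *ᵥ θ.ofLp) (s t) - y (s t)) ^ 2 =
      (Φ (s t) ⬝ᵥ θ.ofLp) ^ 2 - 2 * (y (s t) * (θ.ofLp ⬝ᵥ Φ (s t))) + y (s t) ^ 2 := fun t => by
    rw [mulVec, dotProduct_comm θ.ofLp]
    ring
  simp only [h2, Finset.sum_add_distrib, Finset.sum_sub_distrib, ← Finset.mul_sum]
  ring

theorem isMinOn_exactObjective_iff {Φ : Matrix X (Fin M) ℝ} {q : stdSimplex ℝ X}
    (hΦ : (featureCov Φ q).det ≠ 0) (y : X → ℝ) (θ : EuclideanSpace ℝ (Fin M)) :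
    IsMinOn (exactObjective q Φ y) Set.univ θ ↔
      θ = WithLp.toLp 2 ((featureCov Φ q)⁻¹ *ᵥ ∑ i, q.1 i • y i • Φ i) := by
  refine isMinOn_quadratic_iff (posDef_featureCov hΦ) _ one_pos (∑ i, q.1 i * y i ^ 2)
    (fun θ => ?_) θ
  simp only [exactObjective, featureCov, sum_mulVec, smul_mulVec, dotProduct_smul,
    dotProduct_sum, dotProduct_vecMulVec_mulVec, smul_eq_mul, one_mul, Finset.mul_sum,
    ← Finset.sum_add_distrib, ← Finset.sum_sub_distrib]
  refine Finset.sum_congr rfl fun i _ => ?_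
  rw [mulVec, dotProduct_comm θ.ofLp]
  ring

/-- The solution of the normal equations with state weights `p` and regularization `r * lam`. -/
noncomputable def weightedSolution (lam : ℝ) (Φ : Matrix X (Fin M) ℝ) (y : X → ℝ)
    (z : ℝ × (X → ℝ)) : EuclideanSpace ℝ (Fin M) :=
  WithLp.toLp 2 (((z.1 * lam) • (1 : Matrix (Fin M) (Fin M) ℝ)
    + ∑ i, z.2 i • vecMulVec (Φ i) (Φ i))⁻¹ *ᵥ ∑ i, z.2 i • y i • Φ i)

/-- Scaling the Gram matrix and the right-hand side by 1/T cancels in the solution and turns time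
sums into frequency-weighted sums over states. -/
theorem rlsSolution_eq_weightedSolution [DecidableEq X] {lam : ℝ} (hlam : 0 < lam)
    (Φ : Matrix X (Fin M) ℝ) (y : X → ℝ) (s : ℕ → X) {T : ℕ} (hT : 1 ≤ T) :
    rlsSolution lam Φ y s T =
      weightedSolution lam Φ y (1 / (T : ℝ), Chain.empiricalFreq s T) := by
  have hT0 : (T : ℝ) ≠ 0 := by positivity
  simp only [weightedSolution, Chain.sum_empiricalFreq_smul s T fun i => vecMulVec (Φ i) (Φ i),
    Chain.sum_empiricalFreq_smul s T fun i => y i • Φ i, mul_smul, ← smul_add]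
  have hinv : ((1 / (T : ℝ)) • gram lam Φ s T)⁻¹ = (T : ℝ) • (gram lam Φ s T)⁻¹ :=
    inv_eq_left_inv (by simp [smul_smul, hT0, (posDef_gram hlam Φ s T).det_pos.ne'])
  rw [← gram, hinv, smul_mulVec, mulVec_smul, smul_smul, mul_one_div_cancel hT0, one_smul,
    rlsSolution]

theorem continuousAt_weightedSolution (lam : ℝ) {Φ : Matrix X (Fin M) ℝ} {q : stdSimplex ℝ X}
    (hΦ : (featureCov Φ q).det ≠ 0) (y : X → ℝ) :
    ContinuousAt (weightedSolution lam Φ y) (0, q.1) := by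
  let A : ℝ × (X → ℝ) → Matrix (Fin M) (Fin M) ℝ := fun z =>
    (z.1 * lam) • (1 : Matrix (Fin M) (Fin M) ℝ) + ∑ i, z.2 i • vecMulVec (Φ i) (Φ i)
  have hA : Continuous A := by fun_prop
  have hA0 : (A (0, q.1)).det ≠ 0 := by simpa [A, featureCov] using hΦ
  have hinv : ContinuousAt (fun z => (A z)⁻¹) (0, q.1) := by
    -- Cramer's formula: the inverse is det⁻¹ times the adjugate, continuous where det ≠ 0.
    simp only [Matrix.inv_def, Ring.inverse_eq_inv']
    exact (hA.matrix_det.continuousAt.inv₀ hA0).smul hA.matrix_adjugate.continuousAt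
  have hb : Continuous fun z : ℝ × (X → ℝ) => ∑ i, z.2 i • y i • Φ i := by
    fun_prop
  refine (PiLp.continuous_toLp 2 _).continuousAt.comp ?_
  have hmv : Continuous fun w : Matrix (Fin M) (Fin M) ℝ × (Fin M → ℝ) => w.1 *ᵥ w.2 :=
    continuous_fst.matrix_mulVec continuous_snd
  exact hmv.continuousAt.comp (hinv.prodMk hb.continuousAt)

end PolicyEval

theorem theoremt {X C : Type*} [Fintype X] [DecidableEq X]
    -- the decision process, a policy, and the (unique) stationary distribution of its chain
    (D : MDP X C) (π : D.Policy)
    (hP : Chain.IsUnichain (D.policyTrans π))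
    (q : stdSimplex ℝ X) (hq : Chain.IsStationary (D.policyTrans π) q)
    -- discount factor, base transition risk mapping, mini-batch size
    (α : ℝ) (hα : α ∈ Set.Ioo (0 : ℝ) 1)
    (σ : X → stdSimplex ℝ X → (X → ℝ) → ℝ) (hσ : ∀ i p, Risk.IsCoherent (σ i p))
    (N : ℕ) [NeZero N]
    -- features, regularization parameter, reference parameter, initial distribution
    {M : ℕ} (Φ : Matrix X (Fin M) ℝ) (hΦ : (PolicyEval.featureCov Φ q).det ≠ 0)
    (lam : ℝ) (hlam : 0 < lam) (θref : EuclideanSpace ℝ (Fin M)) (P₀ : stdSimplex ℝ X)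
    -- the regression targets `c^π(i) + α σ⁽ᴺ⁾_i(P^π_i, Φ θref)`
    (y : X → ℝ)
    (hy : y = PolicyEval.target (D.policyTrans π) (D.policyCost π) α (Risk.miniBatch σ N) Φ θref) :
    -- along every path, `rlsSolution` is the only minimizer of the regularized problem
    (∀ (s : ℕ → X) (T : ℕ), 1 ≤ T → ∀ θ : EuclideanSpace ℝ (Fin M),
      IsMinOn (PolicyEval.sampleObjective lam Φ y s T) Set.univ θ ↔
        θ = PolicyEval.rlsSolution lam Φ y s T) ∧
    -- the exact problem has a unique minimizer `θnext`
    ∃ θnext : EuclideanSpace ℝ (Fin M),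
      (∀ θ : EuclideanSpace ℝ (Fin M),
        IsMinOn (PolicyEval.exactObjective q Φ y) Set.univ θ ↔ θ = θnext) ∧
      ∀ δ : ℝ, 0 < δ → ∀ ε : ℝ, 0 < ε → ∃ T₀ : ℕ,
        ∀ (Ω : Type*) [MeasurableSpace Ω] (μ : MeasureTheory.Measure Ω)
          [MeasureTheory.IsProbabilityMeasure μ] (s : ℕ → Ω → X),
          Chain.IsMarkovChain P₀ (D.policyTrans π) μ s →
          ∀ T : ℕ, T₀ ≤ T →
            1 - δ ≤ μ.real {ω | ‖PolicyEval.rlsSolution lam Φ y (fun t => s t ω) T - θnext‖ ≤ ε} := by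
  subst hy
  set y := PolicyEval.target (D.policyTrans π) (D.policyCost π) α (Risk.miniBatch σ N) Φ θref
  refine ⟨fun s T hT θ => PolicyEval.isMinOn_sampleObjective_iff hlam Φ y s hT θ, _,
    PolicyEval.isMinOn_exactObjective_iff hΦ y, fun δ hδ ε hε => ?_⟩
  have h0 : PolicyEval.weightedSolution lam Φ y (0, q.1) =
      WithLp.toLp 2 ((PolicyEval.featureCov Φ q)⁻¹ *ᵥ ∑ i, q.1 i • y i • Φ i) := by
    simp [PolicyEval.weightedSolution, PolicyEval.featureCov]
  obtain ⟨η, hη, hclose⟩ := Metric.continuousAt_iff.1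
    (PolicyEval.continuousAt_weightedSolution lam hΦ y) ε hε
  obtain ⟨T₁, hT₁⟩ := hP.exists_forall_real_dist_lt hq hδ hη
  obtain ⟨T₂, hT₂⟩ := exists_nat_one_div_lt hη
  -- `T₁` controls the frequencies and `T₂ + 1` makes 1/T < η; on the product both stay within η of
  -- (0, q).
  refine ⟨max T₁ (T₂ + 1), fun Ω _ μ _ s hs T hT => (hT₁ Ω μ P₀ s hs T
    ((le_max_left _ _).trans hT)).trans (MeasureTheory.measureReal_mono fun ω hω => ?_)⟩
  have hT' : T₂ + 1 ≤ T := (le_max_right _ _).trans hT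
  have hr : dist (1 / (T : ℝ)) 0 < η := by
    rw [Real.dist_eq, sub_zero, abs_of_nonneg (by positivity)]
    refine lt_of_le_of_lt (one_div_le_one_div_of_le (by positivity) ?_) hT₂
    exact_mod_cast hT'
  have := hclose (x := (1 / (T : ℝ), Chain.empiricalFreq (fun t => s t ω) T))
    (by rw [Prod.dist_eq]; exact max_lt hr hω)
  rw [h0, ← PolicyEval.rlsSolution_eq_weightedSolution hlam Φ y _ (by omega), dist_eq_norm] at this
  exact this.le
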